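/- Let $\mathbb P^9$ be the space of plane cubic curves over $\mathbb C$, the point $\bar a=(a_{i,j})_{0\le i+j\le 3}$ corresponding to the curve $C_{\bar a}\subset\mathbb P^2$ with equation $F(\bar a,\bar z)=\sum_{0\le i+j\le 3}a_{i,j}z_1^iz_2^jz_3^{3-i-j}=0$. The inflection points of $C_{\bar a}$ are the points of $C_{\bar a}$ at which the Hessian determinant $\det\left(\partial^2F(\bar a,\bar z)/\partial z_i\partial z_j\right)$ vanishes. A two-dimensional linear subspace (plane) $\Pi\subset\mathbb P^9$ defines the net $\mathcal C_\Pi$ of the cubic curves $C_{\bar a}$, $\bar a\in\Pi$. The net $\mathcal C_\Pi$ satisfies the additional generality condition if for every point $\bar z\in\mathbb P^2$ there are only finitely many curves in $\mathcal C_\Pi$ that pass through $\bar z$ and have $\bar z$ as an inflection point. Let $\mathcal W$ be any nonempty Zariski open subset of the Grassmannian $Gr(3,10)$ of planes $\Pi\subset\mathbb P^9$ (for instance, one consisting of planes for which the associated projection $\mathbb P^2\to\hat\Pi$ of the Veronese surface is a generic covering). Then there is a nonempty Zariski open subset $\mathcal W_1\subset\mathcal W$ such that for every $\Pi\in\mathcal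 W_1$ the net $\mathcal C_\Pi$ satisfies the additional generality condition. -/

import Mathlib

open scoped LinearAlgebra.Projectivization

noncomputable section

/-- The ten index pairs `(i, j)`, `0 ≤ i + j ≤ 3`, of the coefficients of a ternary cubic form. -/
abbrev CubicIndex : Type := {p : Fin 4 × Fin 4 // (p.1 : ℕ) + (p.2 : ℕ) ≤ 3}

/-- The cubic form `F(a, z) = ∑ a_{i,j} z₁ⁱ z₂ʲ z₃³⁻ⁱ⁻ʲ`; the variables `z₁, z₂, z₃` are
`X 0, X 1, X 2`. -/
def cubicForm (a : CubicIndex → ℂ) : MvPolynomial (Fin 3) ℂ :=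
  ∑ p : CubicIndex, MvPolynomial.C (a p) * (MvPolynomial.X 0 ^ (p.1.1 : ℕ) *
    MvPolynomial.X 1 ^ (p.1.2 : ℕ) * MvPolynomial.X 2 ^ (3 - (p.1.1 : ℕ) - (p.1.2 : ℕ)))

/-- The space `ℙ⁹` parametrizing plane cubic curves. -/
abbrev CubicParam : Type := ℙ ℂ (CubicIndex → ℂ)

/-- The complex projective plane `ℙ²`. -/
abbrev ProjPlane : Type := ℙ ℂ (Fin 3 → ℂ)

/-- The Hessian determinant `det (∂²F / ∂zᵢ∂zⱼ)`. -/
def hessian (F : MvPolynomial (Fin 3) ℂ) : MvPolynomial (Fin 3) ℂ :=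
  (Matrix.of fun i j => MvPolynomial.pderiv i (MvPolynomial.pderiv j F)).det

/-- The plane cubic curve with parameter `a`, as a set of points of `ℙ²`. -/
def cubicCurve (a : CubicParam) : Set ProjPlane :=
  {z | MvPolynomial.eval z.rep (cubicForm a.rep) = 0}

/-- The Hesse curve of the cubic curve with parameter `a` (all of `ℙ²` if the Hessian of the
cubic form is the zero polynomial). -/
def hesseCurve (a : CubicParam) : Set ProjPlane :=
  {z | MvPolynomial.eval z.rep (hessian (cubicForm a.rep)) = 0}

/-- The inflection points of a cubic curve: its common points with its Hesse curve. -/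
def inflectionPoints (a : CubicParam) : Set ProjPlane :=
  cubicCurve a ∩ hesseCurve a

/-- The Grassmannian `Gr(3, 10)` of projective planes in `ℙ⁹`, each given as the
three-dimensional linear subspace of `ℂ¹⁰` of which it is the projectivization. -/
structure CubicPlane where
  toSubmodule : Submodule ℂ (CubicIndex → ℂ)
  finrank_eq : Module.finrank ℂ toSubmodule = 3

/-- The points of the plane, i.e. the parameters of the cubic curves of the net. -/
def CubicPlane.points (P : CubicPlane) : Set CubicParam :=
  {a | a.submodule ≤ P.toSubmodule}

/-- A frame: three linearly independent vectors of `ℂ¹⁰`. -/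
abbrev CubicFrame : Type := {A : Fin 3 → CubicIndex → ℂ // LinearIndependent ℂ A}

namespace CubicFrame

/-- The entries of the `3 × 10` matrix of a frame, as a point of the affine space `𝔸³⁰`. -/
def coords (A : CubicFrame) : Fin 3 × CubicIndex → ℂ :=
  fun p => A.1 p.1 p.2

/-- The plane spanned by a frame. -/
def plane (A : CubicFrame) : CubicPlane where
  toSubmodule := Submodule.span ℂ (Set.range A.1)
  finrank_eq := by
    have h := finrank_span_eq_card A.2
    simpa using h

end CubicFrame

/-- The Zariski topology on a complex affine space: the closed sets are the common zero sets of
families of polynomials. -/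
abbrev affineZariski (σ : Type) : TopologicalSpace (σ → ℂ) :=
  TopologicalSpace.induced (MvPolynomial.pointToPoint (k := ℂ) (K := ℂ) (σ := σ)) inferInstance

/-- The Zariski topology on the Grassmannian, as the quotient of the variety of frames (an open
subvariety of the affine space of `3 × 10` matrices) by `GL₃`. -/
instance : TopologicalSpace CubicPlane :=
  TopologicalSpace.coinduced CubicFrame.plane
    (TopologicalSpace.induced CubicFrame.coords (affineZariski _))

/-- The additional generality condition on the net of cubics parametrized by `P`: each point of
`ℙ²` is an inflection point of only finitely many curves of the net. -/
def AdditionalGenerality (P : CubicPlane) : Prop :=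
  ∀ z : ProjPlane, {a ∈ P.points | z ∈ inflectionPoints a}.Finite

/-! ### Basic facts about the definitions -/

theorem card_cubicIndex : Fintype.card CubicIndex = 10 := by decide

theorem cubicForm_smul (s : ℂ) (a : CubicIndex → ℂ) :
    cubicForm (s • a) = MvPolynomial.C s * cubicForm a := by
  simp only [cubicForm, Finset.mul_sum, Pi.smul_apply, smul_eq_mul, map_mul, mul_assoc]

theorem cubicForm_isHomogeneous (a : CubicIndex → ℂ) : (cubicForm a).IsHomogeneous 3 := by
  refine MvPolynomial.IsHomogeneous.sum _ _ _ fun p _ => ?_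
  refine MvPolynomial.IsHomogeneous.C_mul ?_ _
  have h := (((MvPolynomial.isHomogeneous_X_pow (R := ℂ) (0 : Fin 3) (p.1.1 : ℕ)).mul
    (MvPolynomial.isHomogeneous_X_pow (R := ℂ) (1 : Fin 3) (p.1.2 : ℕ))).mul
    (MvPolynomial.isHomogeneous_X_pow (R := ℂ) (2 : Fin 3) (3 - (p.1.1 : ℕ) - (p.1.2 : ℕ))))
  have e : (p.1.1 : ℕ) + (p.1.2 : ℕ) + (3 - (p.1.1 : ℕ) - (p.1.2 : ℕ)) = 3 := by
    have := p.2
    omega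
  rwa [e] at h

theorem eval_smul_of_isHomogeneous {F : MvPolynomial (Fin 3) ℂ} {n : ℕ} (hF : F.IsHomogeneous n)
    (r : ℂ) (v : Fin 3 → ℂ) :
    MvPolynomial.eval (r • v) F = r ^ n * MvPolynomial.eval v F := by
  rw [MvPolynomial.eval_eq, MvPolynomial.eval_eq, Finset.mul_sum]
  refine Finset.sum_congr rfl fun d hd => ?_
  have h := hF.degree_eq_sum_deg_support hd
  simp only [Pi.smul_apply, smul_eq_mul, mul_pow, Finset.prod_mul_distrib,
    Finset.prod_pow_eq_pow_sum]
  rw [← h]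
  ring

theorem hessian_isHomogeneous {F : MvPolynomial (Fin 3) ℂ} (hF : F.IsHomogeneous 3) :
    (hessian F).IsHomogeneous 3 := by
  have h : ∀ i j, (MvPolynomial.pderiv i (MvPolynomial.pderiv j F)).IsHomogeneous 1 :=
    fun i j => (hF.pderiv (i := j)).pderiv (i := i)
  have h3 : ∀ i j k l m n,
      (MvPolynomial.pderiv i (MvPolynomial.pderiv j F) *
        MvPolynomial.pderiv k (MvPolynomial.pderiv l F) *
        MvPolynomial.pderiv m (MvPolynomial.pderiv n F)).IsHomogeneous 3 :=
    fun i j k l m n => ((h i j).mul (h k l)).mul (h m n)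
  unfold hessian
  rw [Matrix.det_fin_three]
  simp only [Matrix.of_apply]
  exact ((((((h3 _ _ _ _ _ _).sub (h3 _ _ _ _ _ _)).sub (h3 _ _ _ _ _ _)).add
    (h3 _ _ _ _ _ _)).add (h3 _ _ _ _ _ _)).sub (h3 _ _ _ _ _ _))

theorem hessian_C_mul (s : ℂ) (F : MvPolynomial (Fin 3) ℂ) :
    hessian (MvPolynomial.C s * F) = MvPolynomial.C s ^ 3 * hessian F := by
  unfold hessian
  rw [Matrix.det_fin_three, Matrix.det_fin_three]
  simp only [Matrix.of_apply, MvPolynomial.pderiv_C_mul]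
  ring

/-- Membership in a cubic curve may be tested on any representatives. -/
theorem mem_cubicCurve_mk (a : CubicIndex → ℂ) (ha : a ≠ 0) (v : Fin 3 → ℂ) (hv : v ≠ 0) :
    Projectivization.mk ℂ v hv ∈ cubicCurve (Projectivization.mk ℂ a ha) ↔
      MvPolynomial.eval v (cubicForm a) = 0 := by
  obtain ⟨r, hr⟩ := Projectivization.exists_smul_eq_mk_rep ℂ v hv
  obtain ⟨s, hs⟩ := Projectivization.exists_smul_eq_mk_rep ℂ a ha
  change MvPolynomial.eval _ (cubicForm _) = 0 ↔ _
  rw [← hr, ← hs, Units.smul_def, Units.smul_def, cubicForm_smul, map_mul,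
    eval_smul_of_isHomogeneous (cubicForm_isHomogeneous a)]
  simp

/-- Membership in a Hesse curve may be tested on any representatives. -/
theorem mem_hesseCurve_mk (a : CubicIndex → ℂ) (ha : a ≠ 0) (v : Fin 3 → ℂ) (hv : v ≠ 0) :
    Projectivization.mk ℂ v hv ∈ hesseCurve (Projectivization.mk ℂ a ha) ↔
      MvPolynomial.eval v (hessian (cubicForm a)) = 0 := by
  obtain ⟨r, hr⟩ := Projectivization.exists_smul_eq_mk_rep ℂ v hv
  obtain ⟨s, hs⟩ := Projectivization.exists_smul_eq_mk_rep ℂ a ha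
  change MvPolynomial.eval _ (hessian (cubicForm _)) = 0 ↔ _
  rw [← hr, ← hs, Units.smul_def, Units.smul_def, cubicForm_smul, hessian_C_mul, map_mul,
    eval_smul_of_isHomogeneous (hessian_isHomogeneous (cubicForm_isHomogeneous a))]
  simp

/-- Every plane in `ℙ⁹` is spanned by a frame. -/
theorem CubicFrame.plane_surjective : Function.Surjective CubicFrame.plane := by
  rintro ⟨W, hW⟩
  let b := Module.finBasisOfFinrankEq ℂ W hW
  refine ⟨⟨fun i => (b i : CubicIndex → ℂ), ?_⟩, ?_⟩
  · exact b.linearIndependent.map' W.subtype W.ker_subtype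
  · have h := congrArg (Submodule.map W.subtype) b.span_eq
    rw [Submodule.map_span, Submodule.map_top, Submodule.range_subtype, ← Set.range_comp] at h
    unfold CubicFrame.plane
    congr 1

/-- A set of planes is Zariski open iff, for some family of polynomials in the entries of a
frame, it consists of the planes at whose frames not all of these polynomials vanish. -/
theorem isOpen_cubicPlane_iff (U : Set CubicPlane) :
    IsOpen U ↔ ∃ S : Set (MvPolynomial (Fin 3 × CubicIndex) ℂ), ∀ A : CubicFrame,
      A.plane ∈ U ↔ ∃ f ∈ S, MvPolynomial.eval A.coords f ≠ 0 := by
  have key : ∀ (S : Set (MvPolynomial (Fin 3 × CubicIndex) ℂ)) (x : Fin 3 × CubicIndex → ℂ),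
      MvPolynomial.pointToPoint (k := ℂ) x ∉ PrimeSpectrum.zeroLocus S ↔
        ∃ f ∈ S, MvPolynomial.eval x f ≠ 0 := by
    intro S x
    rw [PrimeSpectrum.mem_zeroLocus, Set.not_subset]
    refine exists_congr fun f => and_congr_right fun _ => not_congr ?_
    change f ∈ MvPolynomial.vanishingIdeal ℂ {x} ↔ _
    rw [MvPolynomial.mem_vanishingIdeal_singleton_iff, MvPolynomial.aeval_eq_eval]
  constructor
  · rintro ⟨V, ⟨T, hT, rfl⟩, hV⟩
    obtain ⟨S, hS⟩ := (PrimeSpectrum.isOpen_iff T).1 hT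
    refine ⟨S, fun A => ?_⟩
    rw [← key, ← hS, Set.notMem_compl_iff]
    exact (Set.ext_iff.1 hV A).symm
  · rintro ⟨S, hS⟩
    refine ⟨_, ⟨(PrimeSpectrum.zeroLocus S)ᶜ,
      (PrimeSpectrum.isClosed_zeroLocus S).isOpen_compl, rfl⟩, ?_⟩
    ext A
    exact (key S A.coords).trans (hS A).symm

end

/-! Fix a point z. If z is not a base point of the net, the cubics of the net through z form a
pencil, and the Hessian determinant at z restricts to a binary cubic form on this pencil. Unless
that form vanishes identically, it has finitely many zeros (`finite_inflection`). So a net fails the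
condition only if it has a base point, or if for some z all Hessians of its pencil through z vanish
at z.

Both kinds of failure are excluded by counting parameters in the 30-dimensional space of frames. A
base point leaves 2 + 3·9 = 29 parameters. For the second kind, take z in an affine chart. At a
point of the curve the Hessian is, up to the factor -8, the value of the quadratic Taylor part q at
the zero of the linear part l (`det_hessMatrix_chart`). A whole pencil on which this vanishes is of
one of four types (`pencil_cases`), each with at most 7 parameters for the two pairs (l, q) instead
of 10. This again gives at most 29 parameters.

The image of a polynomial map from a smaller affine space lies on a hypersurface (`IsThin.range`),
so one nonzero polynomial vanishes at all bad frames. Its nonvanishing locus, saturated under change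
of frame, is the required open set. -/

noncomputable section

/-! ### Cubic forms and their Hessian matrices in coordinates -/

namespace CubicIndex

/-- The index `(i, j)`. -/
abbrev ix (i j : Fin 4) (h : (i : ℕ) + (j : ℕ) ≤ 3 := by decide) : CubicIndex := ⟨(i, j), h⟩

theorem sum_eq {M : Type*} [AddCommMonoid M] (f : CubicIndex → M) :
    ∑ p, f p = f (ix 3 0) + f (ix 2 1) + f (ix 1 2) + f (ix 0 3) + f (ix 2 0) + f (ix 1 1) +
      f (ix 0 2) + f (ix 1 0) + f (ix 0 1) + f (ix 0 0) := by
  have h : (Finset.univ : Finset CubicIndex) = {ix 3 0, ix 2 1, ix 1 2, ix 0 3, ix 2 0, ix 1 1,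
      ix 0 2, ix 1 0, ix 0 1, ix 0 0} := by decide
  rw [h]
  repeat rw [Finset.sum_insert (by decide)]
  rw [Finset.sum_singleton]
  simp only [add_assoc]

end CubicIndex

open CubicIndex

/-- The value of a cubic form. -/
theorem eval_cubicForm (a : CubicIndex → ℂ) (z : Fin 3 → ℂ) :
    MvPolynomial.eval z (cubicForm a) =
      a (ix 3 0) * z 0 ^ 3 + a (ix 2 1) * z 0 ^ 2 * z 1 + a (ix 1 2) * z 0 * z 1 ^ 2 +
      a (ix 0 3) * z 1 ^ 3 + a (ix 2 0) * z 0 ^ 2 * z 2 + a (ix 1 1) * z 0 * z 1 * z 2 +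
      a (ix 0 2) * z 1 ^ 2 * z 2 + a (ix 1 0) * z 0 * z 2 ^ 2 + a (ix 0 1) * z 1 * z 2 ^ 2 +
      a (ix 0 0) * z 2 ^ 3 := by
  rw [cubicForm, CubicIndex.sum_eq]
  simp
  ring

/-- The matrix of second derivatives of a cubic form at a point. -/
def hessMatrix (a : CubicIndex → ℂ) (z : Fin 3 → ℂ) : Matrix (Fin 3) (Fin 3) ℂ :=
  Matrix.of fun i j => MvPolynomial.eval z
    (MvPolynomial.pderiv i (MvPolynomial.pderiv j (cubicForm a)))

theorem eval_hessian (a : CubicIndex → ℂ) (z : Fin 3 → ℂ) :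
    MvPolynomial.eval z (hessian (cubicForm a)) = (hessMatrix a z).det := by
  rw [hessian, RingHom.map_det]
  rfl

theorem hessMatrix_eq (a : CubicIndex → ℂ) (z : Fin 3 → ℂ) :
    hessMatrix a z =
      !![6 * a (ix 3 0) * z 0 + 2 * a (ix 2 1) * z 1 + 2 * a (ix 2 0) * z 2,
         2 * a (ix 2 1) * z 0 + 2 * a (ix 1 2) * z 1 + a (ix 1 1) * z 2,
         2 * a (ix 2 0) * z 0 + a (ix 1 1) * z 1 + 2 * a (ix 1 0) * z 2;
         2 * a (ix 2 1) * z 0 + 2 * a (ix 1 2) * z 1 + a (ix 1 1) * z 2,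
         2 * a (ix 1 2) * z 0 + 6 * a (ix 0 3) * z 1 + 2 * a (ix 0 2) * z 2,
         a (ix 1 1) * z 0 + 2 * a (ix 0 2) * z 1 + 2 * a (ix 0 1) * z 2;
         2 * a (ix 2 0) * z 0 + a (ix 1 1) * z 1 + 2 * a (ix 1 0) * z 2,
         a (ix 1 1) * z 0 + 2 * a (ix 0 2) * z 1 + 2 * a (ix 0 1) * z 2,
         2 * a (ix 1 0) * z 0 + 2 * a (ix 0 1) * z 1 + 6 * a (ix 0 0) * z 2] := by
  have h2 : ∀ i : Fin 3, MvPolynomial.pderiv (R := ℂ) i 2 = 0 := fun i => by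
    exact_mod_cast (MvPolynomial.pderiv (R := ℂ) i).map_natCast 2
  have h3 : ∀ i : Fin 3, MvPolynomial.pderiv (R := ℂ) i 3 = 0 := fun i => by
    exact_mod_cast (MvPolynomial.pderiv (R := ℂ) i).map_natCast 3
  ext i j
  simp only [hessMatrix, Matrix.of_apply, cubicForm, CubicIndex.sum_eq]
  fin_cases i <;> fin_cases j <;>
    simp [MvPolynomial.pderiv_X, Derivation.leibniz, Derivation.leibniz_pow, h2, h3] <;>
    ring

theorem hessMatrix_add (a b : CubicIndex → ℂ) (z : Fin 3 → ℂ) :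
    hessMatrix (a + b) z = hessMatrix a z + hessMatrix b z := by
  ext i j
  simp only [hessMatrix_eq]
  fin_cases i <;> fin_cases j <;> simp <;> ring

theorem hessMatrix_smul (s : ℂ) (a : CubicIndex → ℂ) (z : Fin 3 → ℂ) :
    hessMatrix (s • a) z = s • hessMatrix a z := by
  ext i j
  simp [hessMatrix, cubicForm_smul]

/-- The value of a cubic form as a linear functional of its coefficients. -/
def evalForm (z : Fin 3 → ℂ) : (CubicIndex → ℂ) →ₗ[ℂ] ℂ where
  toFun a := MvPolynomial.eval z (cubicForm a)
  map_add' a b := by simp only [eval_cubicForm, Pi.add_apply]; ring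
  map_smul' s a := by simp [cubicForm_smul]

theorem evalForm_smul (a : CubicIndex → ℂ) (r : ℂ) (z : Fin 3 → ℂ) :
    evalForm (r • z) a = r ^ 3 * evalForm z a :=
  eval_smul_of_isHomogeneous (cubicForm_isHomogeneous a) r z

theorem det_hessMatrix_smul_right (a : CubicIndex → ℂ) (r : ℂ) (z : Fin 3 → ℂ) :
    (hessMatrix a (r • z)).det = r ^ 3 * (hessMatrix a z).det := by
  rw [← eval_hessian, ← eval_hessian,
    eval_smul_of_isHomogeneous (hessian_isHomogeneous (cubicForm_isHomogeneous a))]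

/-! ### Finiteness over a single point -/

/-- A sufficient condition for a point to be an inflection point of only finitely many curves
of a net. -/
theorem finite_inflection {P : CubicPlane} {z : ProjPlane}
    (h₁ : ∃ a ∈ P.toSubmodule, evalForm z.rep a ≠ 0)
    (h₂ : ∃ a ∈ P.toSubmodule, evalForm z.rep a = 0 ∧ (hessMatrix a z.rep).det ≠ 0) :
    {a ∈ P.points | z ∈ inflectionPoints a}.Finite := by
  obtain ⟨a₁, ha₁, hn₁⟩ := h₁
  obtain ⟨a₀, ha₀, he₀, hn₀⟩ := h₂
  have hne : a₀ ≠ 0 := by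
    rintro rfl
    have : hessMatrix (0 : CubicIndex → ℂ) z.rep = 0 := by
      simpa using hessMatrix_smul 0 (0 : CubicIndex → ℂ) z.rep
    exact hn₀ (by rw [this, Matrix.det_zero])
  have hL : ∃ b : CubicIndex → ℂ, ∀ a ∈ P.toSubmodule, evalForm z.rep a = 0 →
      ∃ s t : ℂ, a = s • a₀ + t • b := by
    have hli : LinearIndependent ℂ ![a₀, a₁] := by
      rw [LinearIndependent.pair_iff]
      intro s t hst
      have ht : t = 0 := by
        have := congrArg (evalForm z.rep) hst
        simpa [he₀, hn₁] using this
      subst ht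
      simpa [hne] using hst
    have hle : Submodule.span ℂ (Set.range ![a₀, a₁]) ≤ P.toSubmodule := by
      rw [Submodule.span_le]
      rintro _ ⟨i, rfl⟩
      fin_cases i
      · exact ha₀
      · exact ha₁
    have hlt : Submodule.span ℂ (Set.range ![a₀, a₁]) < P.toSubmodule := by
      refine lt_of_le_of_ne hle fun h => ?_
      have := P.finrank_eq
      rw [← h, finrank_span_eq_card hli] at this
      simp at this
    obtain ⟨b₀, hb₀, hb₁⟩ := SetLike.exists_of_lt hlt
    have hli3 : LinearIndependent ℂ (Fin.cons b₀ ![a₀, a₁] : Fin 3 → CubicIndex → ℂ) :=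
      hli.finCons hb₁
    have hsp : Submodule.span ℂ (Set.range (Fin.cons b₀ ![a₀, a₁] : Fin 3 → CubicIndex → ℂ)) =
        P.toSubmodule := by
      refine Submodule.eq_of_le_of_finrank_eq ?_ ?_
      · rw [Submodule.span_le]
        rintro _ ⟨i, rfl⟩
        refine Fin.cases hb₀ (fun j => ?_) i
        exact hle (Submodule.subset_span ⟨j, rfl⟩)
      · rw [finrank_span_eq_card hli3, P.finrank_eq]
        simp
    -- Here `b₀, a₀, a₁` is a basis of the net. Correcting `b₀` by a multiple of `a₁` makes it
    -- vanish at z, so that `a₀` and the result span the cubics through z.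
    refine ⟨b₀ - (evalForm z.rep b₀ / evalForm z.rep a₁) • a₁, fun a ha h0 => ?_⟩
    rw [← hsp, Submodule.mem_span_range_iff_exists_fun] at ha
    obtain ⟨c, rfl⟩ := ha
    rw [Fin.sum_univ_three] at h0 ⊢
    change evalForm z.rep (c 0 • b₀ + c 1 • a₀ + c 2 • a₁) = 0 at h0
    change ∃ s t : ℂ, c 0 • b₀ + c 1 • a₀ + c 2 • a₁ = _
    simp only [map_add, map_smul, he₀, smul_eq_mul, mul_zero, add_zero] at h0
    refine ⟨c 1, c 0, ?_⟩
    have h2 : c 2 = - (c 0 * (evalForm z.rep b₀ / evalForm z.rep a₁)) := by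
      field_simp
      linear_combination h0
    rw [h2]
    module
  obtain ⟨b, hb⟩ := hL
  -- The Hessian along the affine line r a₀ + b of the pencil; its coefficient in degree 3 is the
  -- Hessian of `a₀` at z, hence nonzero.
  let p : Polynomial ℂ := (Matrix.det ((Polynomial.X : Polynomial ℂ) •
    (hessMatrix a₀ z.rep).map Polynomial.C + (hessMatrix b z.rep).map Polynomial.C))
  have hp : p ≠ 0 := by
    intro h
    have := Polynomial.coeff_det_X_add_C_card (hessMatrix a₀ z.rep) (hessMatrix b z.rep)
    change p.coeff _ = _ at this
    rw [h, Polynomial.coeff_zero] at this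
    exact hn₀ this.symm
  have hev : ∀ r, p.eval r = (hessMatrix (r • a₀ + b) z.rep).det := by
    intro r
    rw [hessMatrix_add, hessMatrix_smul, ← Polynomial.coe_evalRingHom, RingHom.map_det]
    congr 1
    ext i j
    simp
    exact mul_comm _ _
  refine Set.Finite.subset (s := ⋃ r ∈ p.roots.toFinset,
    {a : CubicParam | ∃ t : ℂ, a.rep = t • (r • a₀ + b)}) ?_ ?_
  · refine Set.Finite.biUnion (Finset.finite_toSet _) fun r _ => Set.Subsingleton.finite ?_
    rintro x ⟨t, hx⟩ y ⟨t', hy⟩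
    have ht : t ≠ 0 := by
      rintro rfl
      exact x.rep_nonzero (by simpa using hx)
    have ht' : t' ≠ 0 := by
      rintro rfl
      exact y.rep_nonzero (by simpa using hy)
    rw [← x.mk_rep, ← y.mk_rep, Projectivization.mk_eq_mk_iff']
    refine ⟨t / t', ?_⟩
    rw [hx, hy, smul_smul, div_mul_cancel₀ _ ht']
  · rintro a ⟨haP, hz⟩
    obtain ⟨hz₁, hz₂⟩ := hz
    have har : a.rep ∈ P.toSubmodule := by
      apply haP
      rw [Projectivization.submodule_eq]
      exact Submodule.mem_span_singleton_self _
    obtain ⟨s, t, hst⟩ := hb _ har hz₁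
    change MvPolynomial.eval _ _ = 0 at hz₂
    rw [eval_hessian] at hz₂
    -- The one member missed by the affine line is `a₀` itself, which has nonzero Hessian at z.
    have ht : t ≠ 0 := by
      rintro rfl
      rw [zero_smul, add_zero] at hst
      rw [hst, hessMatrix_smul, Matrix.det_smul] at hz₂
      have hs : s = 0 := by simpa [hn₀] using hz₂
      rw [hs, zero_smul] at hst
      exact a.rep_nonzero hst
    have hst' : a.rep = t • ((s / t) • a₀ + b) := by
      rw [hst, smul_add, smul_smul, mul_div_cancel₀ _ ht]
    simp only [Set.mem_iUnion]
    refine ⟨s / t, ?_, t, hst'⟩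
    rw [Multiset.mem_toFinset, Polynomial.mem_roots hp, Polynomial.IsRoot.def, hev]
    rw [hst', hessMatrix_smul, Matrix.det_smul] at hz₂
    simpa [ht] using hz₂

/-! ### Subsets of hypersurfaces -/

/-- A set of points of an affine space is thin if it lies on a hypersurface. -/
def IsThin {τ : Type} (S : Set (τ → ℂ)) : Prop :=
  ∃ f : MvPolynomial τ ℂ, f ≠ 0 ∧ ∀ x ∈ S, MvPolynomial.eval x f = 0

namespace IsThin

variable {σ τ : Type}

theorem mono {S T : Set (τ → ℂ)} (hT : IsThin T) (h : S ⊆ T) : IsThin S := by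
  obtain ⟨f, hf, h0⟩ := hT
  exact ⟨f, hf, fun x hx => h0 x (h hx)⟩

theorem union {S T : Set (τ → ℂ)} (hS : IsThin S) (hT : IsThin T) : IsThin (S ∪ T) := by
  obtain ⟨f, hf, hf0⟩ := hS
  obtain ⟨g, hg, hg0⟩ := hT
  refine ⟨f * g, mul_ne_zero hf hg, ?_⟩
  rintro x (hx | hx)
  · rw [map_mul, hf0 x hx, zero_mul]
  · rw [map_mul, hg0 x hx, mul_zero]

theorem iUnion {ι : Type} [Finite ι] {S : ι → Set (τ → ℂ)} (hS : ∀ i, IsThin (S i)) :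
    IsThin (⋃ i, S i) := by
  have := Fintype.ofFinite ι
  choose f hf hf0 using hS
  refine ⟨∏ i, f i, Finset.prod_ne_zero_iff.2 fun i _ => hf i, fun x hx => ?_⟩
  obtain ⟨i, hi⟩ := Set.mem_iUnion.1 hx
  rw [map_prod]
  exact Finset.prod_eq_zero (Finset.mem_univ i) (hf0 i x hi)

theorem preimage_comp_equiv {S : Set (σ → ℂ)} (hS : IsThin S) (e : σ ≃ τ) :
    IsThin {x : τ → ℂ | x ∘ e ∈ S} := by
  obtain ⟨f, hf, hf0⟩ := hS
  refine ⟨MvPolynomial.rename e f, ?_, fun x hx => ?_⟩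
  · rwa [Ne, map_eq_zero_iff _ (MvPolynomial.rename_injective _ e.injective)]
  · rw [MvPolynomial.eval_rename]
    exact hf0 _ hx

/-- The image of a polynomial map from an affine space of smaller dimension is thin. -/
theorem range [Fintype σ] [Fintype τ] (h : Fintype.card σ < Fintype.card τ)
    (φ : τ → MvPolynomial σ ℂ) : IsThin (Set.range fun x i => MvPolynomial.eval x (φ i)) := by
  -- The number of algebraically independent polynomials is at most the transcendence degree, which
  -- is the number of variables. A relation between the components of the map is the equation of the
  -- hypersurface.
  have hφ : ¬ AlgebraicIndependent ℂ φ := by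
    intro hi
    have h1 := hi.cardinalMk_le_trdeg
    rw [MvPolynomial.trdeg_of_isDomain] at h1
    simp only [Cardinal.mk_fintype, Cardinal.lift_natCast, Nat.cast_le] at h1
    omega
  rw [algebraicIndependent_iff] at hφ
  push Not at hφ
  obtain ⟨p, hp, hp0⟩ := hφ
  refine ⟨p, hp0, ?_⟩
  rintro _ ⟨x, rfl⟩
  have := congrArg (MvPolynomial.eval x) hp
  rw [map_zero, ← MvPolynomial.coe_aeval_eq_eval, RingHom.coe_coe, ← AlgHom.comp_apply,
    MvPolynomial.comp_aeval] at this
  rwa [← MvPolynomial.aeval_eq_eval]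

end IsThin

/-! ### Taylor expansion of a cubic at a point of the chart -/

theorem CubicIndex.forall_iff {p : CubicIndex → Prop} :
    (∀ i, p i) ↔ p (ix 3 0) ∧ p (ix 2 1) ∧ p (ix 1 2) ∧ p (ix 0 3) ∧ p (ix 2 0) ∧ p (ix 1 1) ∧
      p (ix 0 2) ∧ p (ix 1 0) ∧ p (ix 0 1) ∧ p (ix 0 0) := by
  have h : ∀ i : CubicIndex, i = ix 3 0 ∨ i = ix 2 1 ∨ i = ix 1 2 ∨ i = ix 0 3 ∨ i = ix 2 0 ∨
      i = ix 1 1 ∨ i = ix 0 2 ∨ i = ix 1 0 ∨ i = ix 0 1 ∨ i = ix 0 0 := by decide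
  constructor
  · intro hp
    exact ⟨hp _, hp _, hp _, hp _, hp _, hp _, hp _, hp _, hp _, hp _⟩
  · rintro ⟨h0, h1, h2, h3, h4, h5, h6, h7, h8, h9⟩ i
    rcases h i with rfl | rfl | rfl | rfl | rfl | rfl | rfl | rfl | rfl | rfl <;> assumption

/-- The coefficients of the cubic form through `(u, v, 1)` whose linear, quadratic and cubic parts
at this point have the coefficients `l`, `q` and `c`. -/
def taylorForm {R : Type*} [CommRing R] (u v : R) (l : Fin 2 → R) (q : Fin 3 → R) (c : Fin 4 → R) :
    CubicIndex → R := fun p =>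
  !![q 0 * u ^ 2 + q 1 * u * v + q 2 * v ^ 2 - l 0 * u - l 1 * v
        - c 0 * u ^ 3 - c 1 * u ^ 2 * v - c 2 * u * v ^ 2 - c 3 * v ^ 3,
      l 1 - q 1 * u - 2 * q 2 * v + c 1 * u ^ 2 + 2 * c 2 * u * v + 3 * c 3 * v ^ 2,
      q 2 - c 2 * u - 3 * c 3 * v, c 3;
    l 0 - 2 * q 0 * u - q 1 * v + 3 * c 0 * u ^ 2 + 2 * c 1 * u * v + c 2 * v ^ 2,
      q 1 - 2 * c 1 * u - 2 * c 2 * v, c 2, 0;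
    q 0 - 3 * c 0 * u - c 1 * v, c 1, 0, 0;
    c 0, 0, 0, 0] p.1.1 p.1.2

/-- Allows the same formula to be read with indeterminates, as a polynomial parametrization, and
with their values. -/
theorem map_taylorForm {R S : Type*} [CommRing R] [CommRing S] (f : R →+* S) (u v : R)
    (l : Fin 2 → R) (q : Fin 3 → R) (c : Fin 4 → R) (p : CubicIndex) :
    f (taylorForm u v l q c p) =
      taylorForm (f u) (f v) (fun i => f (l i)) (fun i => f (q i)) (fun i => f (c i)) p := by
  revert p
  rw [CubicIndex.forall_iff]
  simp [taylorForm, map_ofNat f 2, map_ofNat f 3]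

/-- The linear part of a cubic form at `(u, v, 1)`. -/
def linearPart (u v : ℂ) (a : CubicIndex → ℂ) : Fin 2 → ℂ :=
  ![3 * a (ix 3 0) * u ^ 2 + 2 * a (ix 2 1) * u * v + a (ix 1 2) * v ^ 2 + 2 * a (ix 2 0) * u +
      a (ix 1 1) * v + a (ix 1 0),
    a (ix 2 1) * u ^ 2 + 2 * a (ix 1 2) * u * v + 3 * a (ix 0 3) * v ^ 2 + a (ix 1 1) * u +
      2 * a (ix 0 2) * v + a (ix 0 1)]

/-- The quadratic part of a cubic form at `(u, v, 1)`. -/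
def quadraticPart (u v : ℂ) (a : CubicIndex → ℂ) : Fin 3 → ℂ :=
  ![a (ix 2 0) + 3 * a (ix 3 0) * u + a (ix 2 1) * v,
    a (ix 1 1) + 2 * a (ix 2 1) * u + 2 * a (ix 1 2) * v,
    a (ix 0 2) + a (ix 1 2) * u + 3 * a (ix 0 3) * v]

/-- The cubic part of a cubic form at `(u, v, 1)`. -/
def cubicPart (a : CubicIndex → ℂ) : Fin 4 → ℂ :=
  ![a (ix 3 0), a (ix 2 1), a (ix 1 2), a (ix 0 3)]

theorem linearPart_comb (u v s t : ℂ) (a b : CubicIndex → ℂ) (i : Fin 2) :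
    linearPart u v (s • a + t • b) i = s * linearPart u v a i + t * linearPart u v b i := by
  fin_cases i <;> simp [linearPart] <;> ring

theorem quadraticPart_comb (u v s t : ℂ) (a b : CubicIndex → ℂ) (i : Fin 3) :
    quadraticPart u v (s • a + t • b) i =
      s * quadraticPart u v a i + t * quadraticPart u v b i := by
  fin_cases i <;> simp [quadraticPart] <;> ring

theorem evalForm_chart (u v : ℂ) (a : CubicIndex → ℂ) :
    evalForm ![u, v, 1] a = a (ix 3 0) * u ^ 3 + a (ix 2 1) * u ^ 2 * v + a (ix 1 2) * u * v ^ 2 +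
      a (ix 0 3) * v ^ 3 + a (ix 2 0) * u ^ 2 + a (ix 1 1) * u * v + a (ix 0 2) * v ^ 2 +
      a (ix 1 0) * u + a (ix 0 1) * v + a (ix 0 0) := by
  change MvPolynomial.eval _ _ = _
  rw [eval_cubicForm]
  simp

/-- Taylor's formula: once the constant term vanishes, nine coefficients determine the cubic. This
is the source of the parametrizations in the dimension counts. -/
theorem eq_taylorForm {u v : ℂ} {a : CubicIndex → ℂ} (h : evalForm ![u, v, 1] a = 0) :
    a = taylorForm u v (linearPart u v a) (quadraticPart u v a) (cubicPart a) := by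
  rw [evalForm_chart] at h
  rw [funext_iff, CubicIndex.forall_iff]
  simp only [taylorForm, linearPart, quadraticPart, cubicPart]
  simp
  refine ⟨?_, ?_, ?_, ?_, ?_, ?_⟩
  iterate 5 ring
  linear_combination h

/-- By Euler's relations, row and column operations bring the Hessian matrix to the bordered form
with rows (2q₀, q₁, 2l₀), (q₁, 2q₂, 2l₁), (2l₀, 2l₁, 6F). Its determinant is the right-hand side
plus 6(4q₀q₂ - q₁²)F, and F = 0 at the point. -/
theorem det_hessMatrix_chart {u v : ℂ} {a : CubicIndex → ℂ} (h : evalForm ![u, v, 1] a = 0) :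
    (hessMatrix a ![u, v, 1]).det = -8 * (quadraticPart u v a 0 * linearPart u v a 1 ^ 2 -
      quadraticPart u v a 1 * linearPart u v a 0 * linearPart u v a 1 +
      quadraticPart u v a 2 * linearPart u v a 0 ^ 2) := by
  rw [evalForm_chart] at h
  rw [hessMatrix_eq, Matrix.det_fin_three]
  simp [linearPart, quadraticPart]
  linear_combination 6 * (4 * (a (ix 2 0) + 3 * a (ix 3 0) * u + a (ix 2 1) * v) *
    (a (ix 0 2) + a (ix 1 2) * u + 3 * a (ix 0 3) * v) -
    (a (ix 1 1) + 2 * a (ix 2 1) * u + 2 * a (ix 1 2) * v) ^ 2) * h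

/-! ### Pencils of linear and quadratic parts with vanishing Hessian -/

/-- The coefficients of the product of two binary linear forms. -/
def mulLinear {R : Type*} [CommRing R] (m l : Fin 2 → R) : Fin 3 → R :=
  ![m 0 * l 0, m 0 * l 1 + m 1 * l 0, m 1 * l 1]

/-- The hypothesis says that q vanishes at (l₁, -l₀), the zero of l, so l divides q. -/
theorem exists_mulLinear {l : Fin 2 → ℂ} {q : Fin 3 → ℂ} (hl : l ≠ 0)
    (h : q 0 * l 1 ^ 2 - q 1 * l 0 * l 1 + q 2 * l 0 ^ 2 = 0) : ∃ m, q = mulLinear m l := by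
  by_cases h0 : l 0 = 0
  · have h1 : l 1 ≠ 0 := fun h1 => hl (by ext i; fin_cases i <;> assumption)
    have hq : q 0 = 0 := by simpa [h0, h1] using h
    refine ⟨![q 1 / l 1, q 2 / l 1], ?_⟩
    ext i
    fin_cases i <;> simp [mulLinear, h0, h1, hq]
  · refine ⟨![q 0 / l 0, (q 1 - q 0 / l 0 * l 1) / l 0], ?_⟩
    ext i
    fin_cases i <;> simp [mulLinear] <;> field_simp
    · ring
    · linear_combination h

/-- The pencils of pairs of a binary linear form and a binary quadratic form such that throughout
the pencil the quadratic form vanishes at the zero of the linear form. -/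
theorem pencil_cases (l l' : Fin 2 → ℂ) (q q' : Fin 3 → ℂ)
    (h : ∀ s t : ℂ, (s * q 0 + t * q' 0) * (s * l 1 + t * l' 1) ^ 2 -
      (s * q 1 + t * q' 1) * (s * l 0 + t * l' 0) * (s * l 1 + t * l' 1) +
      (s * q 2 + t * q' 2) * (s * l 0 + t * l' 0) ^ 2 = 0) :
    (∃ m, q = mulLinear m l ∧ q' = mulLinear m l') ∨
    (∃ c c' y m m', l = ![c, c * y] ∧ l' = ![c', c' * y] ∧
      q = mulLinear m ![1, y] ∧ q' = mulLinear m' ![1, y]) ∨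
    (∃ c c' m m', l = ![0, c] ∧ l' = ![0, c'] ∧
      q = mulLinear m ![0, 1] ∧ q' = mulLinear m' ![0, 1]) ∨
    (l = 0 ∧ l' = 0) := by
  -- Four values of the binary cubic in s, t recover its coefficients: `e0`, `e`, `e'`, `e0'` belong
  -- to s³, s²t, st², t³.
  have h10 := h 1 0
  have h01 := h 0 1
  have h11 := h 1 1
  have h1m := h 1 (-1)
  have e : q' 0 * l 1 ^ 2 + 2 * q 0 * l 1 * l' 1 - q' 1 * l 0 * l 1 -
      q 1 * (l' 0 * l 1 + l 0 * l' 1) + q' 2 * l 0 ^ 2 + 2 * q 2 * l 0 * l' 0 = 0 := by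
    linear_combination (h11 - h1m) / 2 - h01
  have e' : q 0 * l' 1 ^ 2 + 2 * q' 0 * l 1 * l' 1 - q 1 * l' 0 * l' 1 -
      q' 1 * (l' 0 * l 1 + l 0 * l' 1) + q 2 * l' 0 ^ 2 + 2 * q' 2 * l 0 * l' 0 = 0 := by
    linear_combination (h11 + h1m) / 2 - h10
  have e0 : q 0 * l 1 ^ 2 - q 1 * l 0 * l 1 + q 2 * l 0 ^ 2 = 0 := by linear_combination h10
  have e0' : q' 0 * l' 1 ^ 2 - q' 1 * l' 0 * l' 1 + q' 2 * l' 0 ^ 2 = 0 := by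
    linear_combination h01
  clear h h10 h01 h11 h1m
  by_cases hl : l = 0 ∧ l' = 0
  · exact .inr (.inr (.inr hl))
  by_cases hD : l 0 * l' 1 - l 1 * l' 0 = 0
  · right
    -- If l = cd and l' = c'd, the cubic is (sc + tc')² times the value of sq + tq' at the zero of
    -- d. The first factor is not identically zero, so d divides both q and q'.
    have key : ∀ (d : Fin 2 → ℂ) (c c' : ℂ), d ≠ 0 → l = c • d → l' = c' • d →
        ∃ m m', q = mulLinear m d ∧ q' = mulLinear m' d := by
      intro d c c' hd hlc hlc'
      have hcc : c ≠ 0 ∨ c' ≠ 0 := by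
        by_contra! hcc
        exact hl ⟨by rw [hlc, hcc.1, zero_smul], by rw [hlc', hcc.2, zero_smul]⟩
      simp only [hlc, hlc', Pi.smul_apply, smul_eq_mul] at e e' e0 e0'
      have hq : q 0 * d 1 ^ 2 - q 1 * d 0 * d 1 + q 2 * d 0 ^ 2 = 0 ∧
          q' 0 * d 1 ^ 2 - q' 1 * d 0 * d 1 + q' 2 * d 0 ^ 2 = 0 := by
        rcases hcc with hc | hc
        · have h1 : q 0 * d 1 ^ 2 - q 1 * d 0 * d 1 + q 2 * d 0 ^ 2 = 0 := by
            refine (mul_eq_zero.1 (?_ : c ^ 2 * _ = 0)).resolve_left (pow_ne_zero 2 hc)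
            linear_combination e0
          refine ⟨h1, (mul_eq_zero.1 (?_ : c ^ 2 * _ = 0)).resolve_left (pow_ne_zero 2 hc)⟩
          linear_combination e - 2 * c * c' * h1
        · have h1 : q' 0 * d 1 ^ 2 - q' 1 * d 0 * d 1 + q' 2 * d 0 ^ 2 = 0 := by
            refine (mul_eq_zero.1 (?_ : c' ^ 2 * _ = 0)).resolve_left (pow_ne_zero 2 hc)
            linear_combination e0'
          refine ⟨(mul_eq_zero.1 (?_ : c' ^ 2 * _ = 0)).resolve_left (pow_ne_zero 2 hc), h1⟩
          linear_combination e' - 2 * c * c' * h1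
      obtain ⟨m, hm⟩ := exists_mulLinear hd hq.1
      obtain ⟨m', hm'⟩ := exists_mulLinear hd hq.2
      exact ⟨m, m', hm, hm'⟩
    by_cases h0 : l 0 = 0 ∧ l' 0 = 0
    · right; left
      obtain ⟨m, m', hm, hm'⟩ := key ![0, 1] (l 1) (l' 1) (by simp)
        (by ext i; fin_cases i <;> simp [h0.1]) (by ext i; fin_cases i <;> simp [h0.2])
      exact ⟨l 1, l' 1, m, m', by ext i; fin_cases i <;> simp [h0.1],
        by ext i; fin_cases i <;> simp [h0.2], hm, hm'⟩
    · left
      obtain ⟨y, hy, hy'⟩ : ∃ y, l 1 = l 0 * y ∧ l' 1 = l' 0 * y := by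
        rcases not_and_or.1 h0 with hn | hn
        · refine ⟨l 1 / l 0, by field_simp, ?_⟩
          field_simp
          linear_combination hD
        · refine ⟨l' 1 / l' 0, ?_, by field_simp⟩
          field_simp
          linear_combination -hD
      obtain ⟨m, m', hm, hm'⟩ := key ![1, y] (l 0) (l' 0) (by simp)
        (by ext i; fin_cases i <;> simp [hy]) (by ext i; fin_cases i <;> simp [hy'])
      exact ⟨l 0, l' 0, y, m, m', by ext i; fin_cases i <;> simp [hy],
        by ext i; fin_cases i <;> simp [hy'], hm, hm'⟩
  · left
    obtain ⟨D, hDe⟩ : ∃ D, D = l 0 * l' 1 - l 1 * l' 0 := ⟨_, rfl⟩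
    rw [← hDe] at hD
    -- With l, l' independent, write m = αl + βl'. Evaluating q = ml at the zero (l'₁, -l'₀) of l'
    -- gives αD², and evaluating q' = ml' at the zero (l₁, -l₀) of l gives βD².
    refine ⟨![((q' 0 * l 1 ^ 2 - q' 1 * l 0 * l 1 + q' 2 * l 0 ^ 2) * l' 0 +
      (q 0 * l' 1 ^ 2 - q 1 * l' 0 * l' 1 + q 2 * l' 0 ^ 2) * l 0) / D ^ 2,
      ((q' 0 * l 1 ^ 2 - q' 1 * l 0 * l 1 + q' 2 * l 0 ^ 2) * l' 1 +
      (q 0 * l' 1 ^ 2 - q 1 * l' 0 * l' 1 + q 2 * l' 0 ^ 2) * l 1) / D ^ 2], ?_, ?_⟩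
    · ext i
      fin_cases i <;> simp [mulLinear] <;> field_simp <;> rw [hDe]
      · linear_combination l' 0 ^ 2 * e0 - l 0 * l' 0 * e
      · linear_combination 2 * l' 0 * l' 1 * e0 - (l 0 * l' 1 + l 1 * l' 0) * e
      · linear_combination l' 1 ^ 2 * e0 - l 1 * l' 1 * e
    · ext i
      fin_cases i <;> simp [mulLinear] <;> field_simp <;> rw [hDe]
      · linear_combination l 0 ^ 2 * e0' - l 0 * l' 0 * e'
      · linear_combination 2 * l 0 * l 1 * e0' - (l 0 * l' 1 + l 1 * l' 0) * e'
      · linear_combination l 1 ^ 2 * e0' - l 1 * l' 1 * e'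

/-! ### Dimension counts for the bad frames -/

open MvPolynomial

/-- The frames all of whose cubics pass through a common point of the chart `z₃ ≠ 0`. -/
def baseLocus : Set (Fin 3 × CubicIndex → ℂ) :=
  {A | ∃ u v : ℂ, ∀ i, evalForm ![u, v, 1] (fun p => A (i, p)) = 0}

theorem isThin_baseLocus : IsThin baseLocus := by
  -- Two parameters for the point and nine Taylor coefficients for each of three cubics: 29 < 30.
  refine (IsThin.range (σ := Fin 2 ⊕ Fin 3 × Fin 9) (by rw [Fintype.card_prod, card_cubicIndex]; simp)
    fun ip => taylorForm (X (.inl 0)) (X (.inl 1))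
      ![X (.inr (ip.1, 0)), X (.inr (ip.1, 1))]
      ![X (.inr (ip.1, 2)), X (.inr (ip.1, 3)), X (.inr (ip.1, 4))]
      ![X (.inr (ip.1, 5)), X (.inr (ip.1, 6)), X (.inr (ip.1, 7)), X (.inr (ip.1, 8))]
      ip.2).mono ?_
  rintro A ⟨u, v, h⟩
  let l i := linearPart u v fun p => A (i, p)
  let q i := quadraticPart u v fun p => A (i, p)
  let c i := cubicPart fun p => A (i, p)
  refine ⟨Sum.elim ![u, v] fun ij => ![l ij.1 0, l ij.1 1, q ij.1 0, q ij.1 1, q ij.1 2,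
    c ij.1 0, c ij.1 1, c ij.1 2, c ij.1 3] ij.2, ?_⟩
  funext ⟨i, p⟩
  refine .trans ?_ (congrFun (eq_taylorForm (h i)) p).symm
  change eval _ (taylorForm _ _ _ _ _ _) = _
  rw [map_taylorForm]
  congr 1
  · simp
  · simp
  · funext j; fin_cases j <;> simp [l]
  · funext j; fin_cases j <;> simp [q]
  · funext j; fin_cases j <;> simp [c]

/-- The frames whose second and third vectors are, modulo the first one, cubics through a common
point `(u, v, 1)` with linear and quadratic parts parametrized by `L` and `Q`. -/
def pencilLocus (L : Fin 2 → Fin 2 → MvPolynomial (Fin 7) ℂ)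
    (Q : Fin 2 → Fin 3 → MvPolynomial (Fin 7) ℂ) : Set (Fin 3 × CubicIndex → ℂ) :=
  {A | ∃ (u v : ℂ) (m : Fin 2 → ℂ) (c : Fin 2 → Fin 4 → ℂ) (y : Fin 7 → ℂ), ∀ (j : Fin 2) p,
    A (j.succ, p) = m j * A (0, p) +
      taylorForm u v (fun i => eval y (L j i)) (fun i => eval y (Q j i)) (c j) p}

theorem isThin_pencilLocus (L : Fin 2 → Fin 2 → MvPolynomial (Fin 7) ℂ)
    (Q : Fin 2 → Fin 3 → MvPolynomial (Fin 7) ℂ) : IsThin (pencilLocus L Q) := by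
  -- Parameters: 2 for the point, 2 multipliers, 10 for the first vector, 8 for the cubic parts and
  -- 7 for the linear and quadratic parts, in all 29 < 30.
  refine (IsThin.range (σ := (Fin 2 ⊕ Fin 2) ⊕ (CubicIndex ⊕ Fin 2 × Fin 4) ⊕ Fin 7)
    (by simp only [Fintype.card_prod, Fintype.card_sum, card_cubicIndex]; simp)
    fun ip => Fin.cases (motive := fun _ => MvPolynomial _ ℂ) (X (.inr (.inl (.inl ip.2))))
      (fun j => X (.inl (.inr j)) * X (.inr (.inl (.inl ip.2))) +
      taylorForm (X (.inl (.inl 0))) (X (.inl (.inl 1)))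
        (fun i => rename (fun k => .inr (.inr k)) (L j i))
        (fun i => rename (fun k => .inr (.inr k)) (Q j i))
        (fun i => X (.inr (.inl (.inr (j, i))))) ip.2) ip.1).mono ?_
  rintro A ⟨u, v, m, c, y, h⟩
  refine ⟨Sum.elim (Sum.elim ![u, v] m)
    (Sum.elim (Sum.elim (fun p => A (0, p)) fun ji => c ji.1 ji.2) y), ?_⟩
  funext ⟨i, p⟩
  refine Fin.cases ?_ (fun j => ?_) i
  · simp
  · rw [h]
    simp only [Fin.cases_succ, map_add, map_mul, eval_X, map_taylorForm, eval_rename]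
    rfl

/-- The frames whose second and third vectors span, modulo the first one, a pencil of cubics
through a point of the chart `z₃ ≠ 0` at which all their Hessians vanish. -/
def inflectionLocus : Set (Fin 3 × CubicIndex → ℂ) :=
  {A | ∃ (u v : ℂ) (m : Fin 2 → ℂ) (B : Fin 2 → CubicIndex → ℂ),
    (∀ j p, A (j.succ, p) = m j * A (0, p) + B j p) ∧ (∀ j, evalForm ![u, v, 1] (B j) = 0) ∧
    ∀ s t : ℂ, (hessMatrix (s • B 0 + t • B 1) ![u, v, 1]).det = 0}

/-- The four alternatives of `pencil_cases` use 6, 7, 6 and 6 of the seven available parameters; an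
unused one is set to 0. -/
theorem isThin_inflectionLocus : IsThin inflectionLocus := by
  refine ((isThin_pencilLocus ![![X 0, X 1], ![X 2, X 3]]
      ![mulLinear ![X 4, X 5] ![X 0, X 1], mulLinear ![X 4, X 5] ![X 2, X 3]]).union
    ((isThin_pencilLocus ![![X 0, X 0 * X 2], ![X 1, X 1 * X 2]]
      ![mulLinear ![X 3, X 4] ![1, X 2], mulLinear ![X 5, X 6] ![1, X 2]]).union
    ((isThin_pencilLocus ![![0, X 0], ![0, X 1]]
      ![mulLinear ![X 3, X 4] ![0, 1], mulLinear ![X 5, X 6] ![0, 1]]).union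
    (isThin_pencilLocus 0 ![![X 0, X 1, X 2], ![X 3, X 4, X 5]])))).mono ?_
  rintro A ⟨u, v, m, B, hA, hB, hd⟩
  have hAB : ∀ (L : Fin 2 → Fin 2 → MvPolynomial (Fin 7) ℂ)
      (Q : Fin 2 → Fin 3 → MvPolynomial (Fin 7) ℂ) (y : Fin 7 → ℂ),
      (∀ j i, eval y (L j i) = linearPart u v (B j) i) →
      (∀ j i, eval y (Q j i) = quadraticPart u v (B j) i) → A ∈ pencilLocus L Q := by
    intro L Q y hL hQ
    refine ⟨u, v, m, fun j => cubicPart (B j), y, fun j p => ?_⟩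
    simp only [hL, hQ]
    rw [hA, ← eq_taylorForm (hB j)]
  rcases pencil_cases (linearPart u v (B 0)) (linearPart u v (B 1)) (quadraticPart u v (B 0))
    (quadraticPart u v (B 1)) (fun s t => by
      have h := hd s t
      rw [det_hessMatrix_chart (by simp [hB])] at h
      simp only [linearPart_comb, quadraticPart_comb] at h
      linear_combination -h / 8) with
    ⟨m, h1, h2⟩ | ⟨c, c', y, m, m', h1, h2, h3, h4⟩ | ⟨c, c', m, m', h1, h2, h3, h4⟩ | ⟨h1, h2⟩
  · refine .inl (hAB _ _ ![linearPart u v (B 0) 0, linearPart u v (B 0) 1,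
      linearPart u v (B 1) 0, linearPart u v (B 1) 1, m 0, m 1, 0] ?_ ?_)
    · intro j i
      fin_cases j <;> fin_cases i <;> simp
    · intro j i
      fin_cases j
      · fin_cases i <;> simp [mulLinear, h1]
      · fin_cases i <;> simp [mulLinear, h2]
  · refine .inr (.inl (hAB _ _ ![c, c', y, m 0, m 1, m' 0, m' 1] ?_ ?_))
    · intro j i
      fin_cases j <;> fin_cases i <;> simp [h1, h2]
    · intro j i
      fin_cases j <;> fin_cases i <;> simp [h3, h4, mulLinear]
  · refine .inr (.inr (.inl (hAB _ _ ![c, c', 0, m 0, m 1, m' 0, m' 1] ?_ ?_)))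
    · intro j i
      fin_cases j <;> fin_cases i <;> simp [h1, h2]
    · intro j i
      fin_cases j <;> fin_cases i <;> simp [h3, h4, mulLinear]
  · refine .inr (.inr (.inr (hAB _ _ ![quadraticPart u v (B 0) 0, quadraticPart u v (B 0) 1,
      quadraticPart u v (B 0) 2, quadraticPart u v (B 1) 0, quadraticPart u v (B 1) 1,
      quadraticPart u v (B 1) 2, 0] ?_ ?_)))
    · intro j i
      fin_cases j <;> fin_cases i <;> simp [h1, h2]
    · intro j i
      fin_cases j <;> fin_cases i <;> simp

/-! ### Reduction to the chart -/

/-- The exchange of a variable with the last one permutes the coefficients of cubic forms. -/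
theorem exists_perm_cubicIndex (j : Fin 3) : ∃ e : Equiv.Perm CubicIndex,
    ∀ (a : CubicIndex → ℂ) (z : Fin 3 → ℂ),
      evalForm (z ∘ Equiv.swap j 2) (a ∘ e) = evalForm z a ∧
      (hessMatrix (a ∘ e) (z ∘ Equiv.swap j 2)).det = (hessMatrix a z).det := by
  have aux : ∀ (e : Equiv.Perm CubicIndex) (σ : Equiv.Perm (Fin 3)),
      (∀ (a : CubicIndex → ℂ) (z : Fin 3 → ℂ), evalForm (z ∘ σ) (a ∘ e) = evalForm z a ∧
        hessMatrix (a ∘ e) (z ∘ σ) = (hessMatrix a z).submatrix σ σ) →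
      ∀ (a : CubicIndex → ℂ) (z : Fin 3 → ℂ), evalForm (z ∘ σ) (a ∘ e) = evalForm z a ∧
        (hessMatrix (a ∘ e) (z ∘ σ)).det = (hessMatrix a z).det := by
    intro e σ h a z
    rw [(h a z).1, (h a z).2, Matrix.det_submatrix_equiv_self]
    exact ⟨rfl, rfl⟩
  fin_cases j
  · let φ : CubicIndex → CubicIndex := fun p =>
      ⟨(⟨3 - p.1.1 - p.1.2, by omega⟩, p.1.2), by have := p.2; simp; omega⟩
    have hφ : ∀ p, φ (φ p) = p := by decide
    obtain ⟨e, hv⟩ : ∃ e : Equiv.Perm CubicIndex,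
        e (ix 3 0) = ix 0 0 ∧ e (ix 2 1) = ix 0 1 ∧ e (ix 1 2) = ix 0 2 ∧
        e (ix 0 3) = ix 0 3 ∧ e (ix 2 0) = ix 1 0 ∧ e (ix 1 1) = ix 1 1 ∧
        e (ix 0 2) = ix 1 2 ∧ e (ix 1 0) = ix 2 0 ∧ e (ix 0 1) = ix 2 1 ∧
        e (ix 0 0) = ix 3 0 :=
      ⟨Function.Involutive.toPerm φ hφ, by decide +revert⟩
    refine ⟨e, aux _ _ fun a z => ⟨?_, ?_⟩⟩
    · change MvPolynomial.eval _ _ = MvPolynomial.eval _ _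
      rw [eval_cubicForm, eval_cubicForm]
      simp [hv, Equiv.swap_apply_def]
      ring
    · rw [hessMatrix_eq, hessMatrix_eq]
      ext i k
      fin_cases i <;> fin_cases k <;> simp [hv, Equiv.swap_apply_def] <;> ring
  · let φ : CubicIndex → CubicIndex := fun p =>
      ⟨(p.1.1, ⟨3 - p.1.1 - p.1.2, by omega⟩), by have := p.2; simp; omega⟩
    have hφ : ∀ p, φ (φ p) = p := by decide
    obtain ⟨e, hv⟩ : ∃ e : Equiv.Perm CubicIndex,
        e (ix 3 0) = ix 3 0 ∧ e (ix 2 1) = ix 2 0 ∧ e (ix 1 2) = ix 1 0 ∧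
        e (ix 0 3) = ix 0 0 ∧ e (ix 2 0) = ix 2 1 ∧ e (ix 1 1) = ix 1 1 ∧
        e (ix 0 2) = ix 0 1 ∧ e (ix 1 0) = ix 1 2 ∧ e (ix 0 1) = ix 0 2 ∧
        e (ix 0 0) = ix 0 3 :=
      ⟨Function.Involutive.toPerm φ hφ, by decide +revert⟩
    refine ⟨e, aux _ _ fun a z => ⟨?_, ?_⟩⟩
    · change MvPolynomial.eval _ _ = MvPolynomial.eval _ _
      rw [eval_cubicForm, eval_cubicForm]
      simp [hv, Equiv.swap_apply_def]
      ring
    · rw [hessMatrix_eq, hessMatrix_eq]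
      ext i k
      fin_cases i <;> fin_cases k <;> simp [hv, Equiv.swap_apply_def] <;> ring
  · exact ⟨1, aux _ _ fun a z => by simp⟩

/-- The frames of nets violating the additional generality condition lie on a hypersurface. -/
theorem isThin_not_additionalGenerality :
    IsThin {x : Fin 3 × CubicIndex → ℂ | ∃ P : CubicPlane,
      P.toSubmodule = Submodule.span ℂ (Set.range fun i p => x (i, p)) ∧
      ¬ AdditionalGenerality P} := by
  choose e he using exists_perm_cubicIndex
  refine (IsThin.iUnion fun j => IsThin.iUnion fun k =>
    (isThin_baseLocus.union isThin_inflectionLocus).preimage_comp_equiv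
      ((Equiv.swap 0 k).prodCongr (e j))).mono ?_
  rintro x ⟨P, hP, hAG⟩
  simp only [AdditionalGenerality, not_forall] at hAG
  obtain ⟨z, hz⟩ := hAG
  obtain ⟨j, hj⟩ := Function.ne_iff.1 z.rep_nonzero
  change z.rep j ≠ 0 at hj
  -- Moving a nonzero coordinate of z to the last place and scaling it to 1 puts z into the chart.
  obtain ⟨w, hw⟩ : ∃ w, w = (z.rep j)⁻¹ • (z.rep ∘ Equiv.swap j 2) := ⟨_, rfl⟩
  have hw3 : w = ![w 0, w 1, 1] := by
    ext i
    fin_cases i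
    · rfl
    · rfl
    · simp [hw, hj]
  have hF : ∀ a, evalForm w (a ∘ e j) = (z.rep j)⁻¹ ^ 3 * evalForm z.rep a := by
    intro a
    rw [hw, evalForm_smul, (he j _ _).1]
  have hH : ∀ a, (hessMatrix (a ∘ e j) w).det = (z.rep j)⁻¹ ^ 3 * (hessMatrix a z.rep).det := by
    intro a
    rw [hw, det_hessMatrix_smul_right, (he j _ _).2]
  have hx : ∀ i, (fun p => x (i, p)) ∈ P.toSubmodule := fun i => by
    rw [hP]
    exact Submodule.subset_span ⟨i, rfl⟩
  simp only [Set.mem_iUnion]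
  refine ⟨j, ?_⟩
  by_cases h₁ : ∃ a ∈ P.toSubmodule, evalForm z.rep a ≠ 0
  -- Since z is not a base point, some vector of the frame does not vanish at z. It is exchanged
  -- with the first one and used to make the other two vanish at z.
  · obtain ⟨k, hk⟩ : ∃ k, evalForm z.rep (fun p => x (k, p)) ≠ 0 := by
      by_contra! h
      obtain ⟨a, ha, hne⟩ := h₁
      have hle : P.toSubmodule ≤ LinearMap.ker (evalForm z.rep) := by
        rw [hP, Submodule.span_le]
        rintro _ ⟨i, rfl⟩
        exact h i
      exact hne (hle ha)
    have h₂ : ∀ a ∈ P.toSubmodule, evalForm z.rep a = 0 → (hessMatrix a z.rep).det = 0 := by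
      by_contra! h₂
      exact hz (finite_inflection h₁ h₂)
    refine ⟨k, .inr ?_⟩
    let A : Fin 3 → CubicIndex → ℂ := fun i p => x (Equiv.swap 0 k i, p)
    have hA0 : evalForm z.rep (A 0) ≠ 0 := by simpa [A] using hk
    let m : Fin 2 → ℂ := fun i => evalForm z.rep (A i.succ) / evalForm z.rep (A 0)
    let B : Fin 2 → CubicIndex → ℂ := fun i => A i.succ - m i • A 0
    have hB : ∀ i, evalForm z.rep (B i) = 0 := fun i => by
      simp [B, m, hA0]
    have hBP : ∀ i, B i ∈ P.toSubmodule := fun i =>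
      P.toSubmodule.sub_mem (hx _) (P.toSubmodule.smul_mem _ (hx _))
    refine ⟨w 0, w 1, m, fun i => B i ∘ e j, fun i p => ?_, fun i => ?_, fun s t => ?_⟩
    · simp [B, A]
    · rw [← hw3, hF, hB, mul_zero]
    · rw [← hw3]
      change (hessMatrix ((s • B 0 + t • B 1) ∘ e j) w).det = 0
      rw [hH, h₂, mul_zero]
      · exact P.toSubmodule.add_mem (P.toSubmodule.smul_mem _ (hBP _))
          (P.toSubmodule.smul_mem _ (hBP _))
      · simp [hB]
  · push Not at h₁
    -- At a base point no exchange of frame vectors is needed.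
    refine ⟨0, .inl ⟨w 0, w 1, fun i => ?_⟩⟩
    rw [← hw3]
    change evalForm w ((fun p => x (Equiv.swap 0 0 i, p)) ∘ e j) = 0
    rw [hF, h₁ _ (hx _), mul_zero]

/-! ### Passage to the Grassmannian -/

/-- The frames whose three vectors are linearly dependent lie on a hypersurface. -/
theorem isThin_not_linearIndependent :
    IsThin {x : Fin 3 × CubicIndex → ℂ | ¬ LinearIndependent ℂ fun i p => x (i, p)} := by
  let c : Fin 3 → CubicIndex := ![ix 0 0, ix 0 1, ix 0 2]
  have hev : ∀ x : Fin 3 × CubicIndex → ℂ, eval x (Matrix.of fun i j : Fin 3 =>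
      (X (i, c j) : MvPolynomial (Fin 3 × CubicIndex) ℂ)).det =
      (Matrix.of fun i j : Fin 3 => x (i, c j)).det := fun x => by
    rw [RingHom.map_det]
    congr 1
    ext i j
    simp
  refine ⟨_, fun h => ?_, fun x hx => (hev x).trans ?_⟩
  -- The minor is a nonzero polynomial, being 1 where the chosen columns form the identity matrix.
  · have := hev fun ip => if ip.2 = c ip.1 then 1 else 0
    rw [h, Matrix.det_fin_three] at this
    simp [c] at this
  · by_contra hd
    refine hx (LinearIndependent.of_comp (LinearMap.funLeft ℂ ℂ c) ?_)
    exact Matrix.linearIndependent_rows_of_det_ne_zero hd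

/-- The planes that contain three vectors at which a given polynomial does not vanish form an open
subset of the Grassmannian. -/
theorem isOpen_planes_eval_ne_zero (f : MvPolynomial (Fin 3 × CubicIndex) ℂ) :
    IsOpen {P : CubicPlane | ∃ x : Fin 3 × CubicIndex → ℂ,
      (∀ i, (fun p => x (i, p)) ∈ P.toSubmodule) ∧ eval x f ≠ 0} := by
  rw [isOpen_cubicPlane_iff]
  -- The triples of vectors in a plane are the products gA of a 3 × 3 matrix g with a frame A, so
  -- openness is witnessed by the polynomials A ↦ f(gA) for all g, invertible or not.
  let φ : Matrix (Fin 3) (Fin 3) ℂ → MvPolynomial (Fin 3 × CubicIndex) ℂ := fun g =>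
    bind₁ (fun ip => ∑ k, C (g ip.1 k) * X (k, ip.2)) f
  have hφ : ∀ g y, eval y (φ g) = eval (fun ip => ∑ k, g ip.1 k * y (k, ip.2)) f := by
    intro g y
    simp only [φ, ← aeval_eq_eval, aeval_bind₁]
    simp [aeval_eq_eval]
  refine ⟨Set.range φ, fun A => ?_⟩
  simp only [Set.exists_range_iff, hφ]
  constructor
  · rintro ⟨x, hx, hf⟩
    have hg : ∀ i, ∃ g : Fin 3 → ℂ, ∑ k, g k • A.1 k = fun p => x (i, p) := fun i =>
      (Submodule.mem_span_range_iff_exists_fun ℂ).1 (hx i)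
    choose g hg using hg
    refine ⟨g, ?_⟩
    convert hf using 3
    funext ⟨i, p⟩
    have := congrFun (hg i) p
    simpa [CubicFrame.coords] using this
  · rintro ⟨g, hg⟩
    refine ⟨_, fun i => ?_, hg⟩
    refine (Submodule.mem_span_range_iff_exists_fun ℂ).2 ⟨g i, ?_⟩
    funext p
    simp [CubicFrame.coords]

theorem mainTheorem10 (W : Set CubicPlane) (hW : IsOpen W) (hne : W.Nonempty) :
    ∃ W₁ : Set CubicPlane, W₁ ⊆ W ∧ IsOpen W₁ ∧ W₁.Nonempty ∧
      ∀ P ∈ W₁, AdditionalGenerality P := by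
  -- Including the dependent triples in the hypersurface ensures that any triple in a plane P with f
  -- ≠ 0 is a basis of P.
  obtain ⟨f, hf, hf0⟩ := isThin_not_additionalGenerality.union isThin_not_linearIndependent
  have hgood : ∀ x, eval x f ≠ 0 → (LinearIndependent ℂ fun i p => x (i, p)) ∧
      ∀ P : CubicPlane, P.toSubmodule = Submodule.span ℂ (Set.range fun i p => x (i, p)) →
        AdditionalGenerality P := by
    refine fun x hx => ⟨?_, fun P hP => ?_⟩
    · by_contra h
      exact hx (hf0 x (.inr h))
    · by_contra h
      exact hx (hf0 x (.inl ⟨P, hP, h⟩))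
  refine ⟨W ∩ _, Set.inter_subset_left, hW.inter (isOpen_planes_eval_ne_zero f), ?_, ?_⟩
  · obtain ⟨S, hS⟩ := (isOpen_cubicPlane_iff W).1 hW
    obtain ⟨P, hP⟩ := hne
    obtain ⟨A, rfl⟩ := CubicFrame.plane_surjective P
    obtain ⟨g, hg, hgA⟩ := (hS A).1 hP
    have hg0 : g ≠ 0 := by
      rintro rfl
      exact hgA (map_zero _)
    -- A nonzero polynomial over an infinite field has a nonzero value; applied to the product, this
    -- gives a frame of a plane in W off the hypersurface.
    obtain ⟨x, hx⟩ : ∃ x, eval x (g * f) ≠ 0 := by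
      by_contra! h
      exact mul_ne_zero hg0 hf (MvPolynomial.funext fun x => by rw [h, map_zero])
    rw [map_mul] at hx
    let A' : CubicFrame := ⟨fun i p => x (i, p), (hgood x (right_ne_zero_of_mul hx)).1⟩
    refine ⟨A'.plane, (hS A').2 ⟨g, hg, left_ne_zero_of_mul hx⟩, x, fun i => ?_,
      right_ne_zero_of_mul hx⟩
    exact Submodule.subset_span ⟨i, rfl⟩
  · rintro P ⟨-, x, hxP, hx⟩
    refine (hgood x hx).2 P (Submodule.eq_of_le_of_finrank_eq ?_ ?_).symm
    · rw [Submodule.span_le]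
      rintro _ ⟨i, rfl⟩
      exact hxP i
    · rw [finrank_span_eq_card (hgood x hx).1, P.finrank_eq]
      simp

end
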